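/- Permutations of $\{1,\dots,n\}$ ($n\ge 0$) are identified with the sequences of their values. A permutation $\sigma$ is *involved in* a permutation $\pi$ (written $\sigma\preceq\pi$; the lengths may differ) if the terms of some subsequence of the values of $\pi$ occur in the same relative order as the sequence of values of $\sigma$. The *shape* $\mathrm{sh}(\pi)$ of $\pi$ is the partition of $n$ formed by the row lengths of the Young tableau that the Robinson–Schensted correspondence (row insertion of the values of $\pi$ from left to right) assigns to $\pi$. For partitions $\lambda,\mu$, possibly of different sizes and extended by trailing zeros, write $\lambda\trianglelefteq\mu$ if $\sum_{i=1}^k\lambda_i\le\sum_{i=1}^k\mu_i$ for all $k\ge 1$, let $\lambda^*$ denote the conjugate partition, $\lambda^*_i=|\{j:\lambda_j\ge i\}|$, and write $\lambda\sqsubseteq\mu$ if both $\lambda\trianglelefteq\mu$ and $\lambda^*\trianglelefteq\mu^*$. **Corollary.** Let $\sigma$ and $\pi$ be permutations. If $\sigma\preceq\pi$, then $\mathrm{sh}(\sigma)\sqsubseteq\mathrm{sh}(\pi)$; that is, $\mathrm{sh}(\sigma)\trianglelefteq\mathrm{sh}(\pi)$ and $\mathrm{sh}(\sigma)^*\trianglelefteq\mathrm{sh}(\pi)^*$.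 -/

import Mathlib

namespace RSK

variable {α : Type*} [LinearOrder α]

/-- Row insertion of `x` into one row: `x` replaces the leftmost entry `y > x`, and `y` is bumped
out (second component `some y`); if there is no such entry, `x` is appended at the end of the row
and nothing is bumped (second component `none`). -/
def rowInsert : List α → α → List α × Option α
  | [], x => ([x], none)
  | y :: r, x =>
    if x < y then (x :: r, some y) else (y :: (rowInsert r x).1, (rowInsert r x).2)

/-- Schensted insertion of `x` into a tableau, given as the list of its rows from top to bottom:
`x` is inserted into the first row, the entry bumped out of it (if any) into the second row, and so
on; an entry bumped out of the last row starts a new row. -/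
def insert : List (List α) → α → List (List α)
  | [], x => [[x]]
  | r :: T, x =>
    match (rowInsert r x).2 with
    | none => (rowInsert r x).1 :: T
    | some y => (rowInsert r x).1 :: insert T y

/-- The insertion tableau (`P`-symbol) of a word: its letters are inserted from left to right into
the empty tableau. -/
def insertionTableau (w : List α) : List (List α) := w.foldl insert []

/-- `ColStrict r s`: the row `s` can be placed below the row `r` in a tableau, i.e. it is no longer
than `r`, and each of its entries is greater than the entry of `r` above it. -/
def ColStrict : List α → List α → Prop
  | _, [] => True
  | [], _ :: _ => False
  | a :: r, b :: s => a < b ∧ ColStrict r s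

theorem ColStrict.length_le : ∀ {r s : List α}, ColStrict r s → s.length ≤ r.length
  | _, [], _ => Nat.zero_le _
  | [], _ :: _, h => h.elim
  | _ :: _, _ :: _, h => Nat.succ_le_succ (ColStrict.length_le h.2)

theorem lt_of_rowInsert_eq_some : ∀ {r : List α} {x y : α}, (rowInsert r x).2 = some y → x < y
  | [], x, y, h => by simp [rowInsert] at h
  | a :: r, x, y, h => by
    by_cases hx : x < a
    · simp only [rowInsert, if_pos hx, Option.some.injEq] at h
      exact h ▸ hx
    · simp only [rowInsert, if_neg hx] at h
      exact lt_of_rowInsert_eq_some h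

theorem ColStrict.rowInsert_left :
    ∀ {r s : List α} (x : α), ColStrict r s → ColStrict (rowInsert r x).1 s
  | _, [], _, _ => by simp [ColStrict]
  | [], _ :: _, _, h => h.elim
  | a :: r, b :: s, x, h => by
    by_cases hx : x < a
    · simp only [rowInsert, if_pos hx]
      exact ⟨hx.trans h.1, h.2⟩
    · simp only [rowInsert, if_neg hx]
      exact ⟨h.1, ColStrict.rowInsert_left x h.2⟩

theorem ColStrict.rowInsert_rowInsert :
    ∀ {r s : List α} {x y : α}, ColStrict r s → (rowInsert r x).2 = some y →
      ColStrict (rowInsert r x).1 (rowInsert s y).1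
  | [], _, _, _, _, h => by simp [rowInsert] at h
  | a :: r, [], x, y, _, h => by
    by_cases hx : x < a
    · simp only [rowInsert, if_pos hx, Option.some.injEq] at h ⊢
      subst h
      exact ⟨hx, by simp [ColStrict]⟩
    · simp only [rowInsert, if_neg hx] at h ⊢
      refine ⟨lt_of_le_of_lt (not_lt.mp hx) (lt_of_rowInsert_eq_some h), ?_⟩
      simp [ColStrict]
  | a :: r, b :: s, x, y, hc, h => by
    by_cases hx : x < a
    · simp only [rowInsert, if_pos hx, Option.some.injEq] at h ⊢
      subst h
      simp only [if_pos hc.1]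
      exact ⟨hx, hc.2⟩
    · simp only [rowInsert, if_neg hx] at h ⊢
      by_cases hy : y < b
      · simp only [if_pos hy]
        exact ⟨lt_of_le_of_lt (not_lt.mp hx) (lt_of_rowInsert_eq_some h),
          hc.2.rowInsert_left x⟩
      · simp only [if_neg hy]
        exact ⟨hc.1, hc.2.rowInsert_rowInsert h⟩

theorem isChain_insert :
    ∀ {T : List (List α)} (x : α), T.IsChain ColStrict → (insert T x).IsChain ColStrict
  | [], _, _ => by simp [insert]
  | [r], x, _ => by
    rcases hy : (rowInsert r x).2 with _ | y
    · simp [insert, hy]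
    · have h : ColStrict r [] := by cases r <;> exact trivial
      simpa [insert, hy, rowInsert] using h.rowInsert_rowInsert hy
  | r :: s :: T, x, h => by
    rw [List.isChain_cons_cons] at h
    rcases hy : (rowInsert r x).2 with _ | y
    · simp only [insert, hy]
      exact List.isChain_cons_cons.mpr ⟨h.1.rowInsert_left x, h.2⟩
    · have ih := isChain_insert y h.2
      have h1 := h.1.rowInsert_rowInsert hy
      rcases hz : (rowInsert s y).2 with _ | z <;>
        simp only [insert, hy, hz] at ih ⊢ <;>
        exact List.isChain_cons_cons.mpr ⟨h1, ih⟩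

theorem isChain_insertionTableau (w : List α) : (insertionTableau w).IsChain ColStrict := by
  have key : ∀ (w : List α) (T : List (List α)), T.IsChain ColStrict →
      (w.foldl insert T).IsChain ColStrict := by
    intro w
    induction w with
    | nil => exact fun _ h => h
    | cons x w ih => exact fun _ h => ih _ (isChain_insert x h)
  exact key w [] List.isChain_nil

/-- The row lengths of an insertion tableau are weakly decreasing. -/
theorem sortedGE_insertionTableau (w : List α) :
    ((insertionTableau w).map List.length).SortedGE := by
  apply List.IsChain.sortedGE
  rw [List.isChain_map]
  exact (isChain_insertionTableau w).imp fun _ _ h => h.length_le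

/-- The shape of a permutation: the partition, as a Young diagram, whose parts are the row lengths
of the insertion tableau of the word `π 0, π 1, …, π (n - 1)`. -/
def shape {n : ℕ} (π : Equiv.Perm (Fin n)) : YoungDiagram :=
  YoungDiagram.ofRowLens ((insertionTableau (List.ofFn π)).map List.length)
    (sortedGE_insertionTableau _)

/-- `σ` is involved in `π`: the values of `π` at some increasing sequence of positions are in the
same relative order as the values of `σ`. -/
def IsInvolvedIn {m n : ℕ} (σ : Equiv.Perm (Fin m)) (π : Equiv.Perm (Fin n)) : Prop :=
  ∃ f : Fin m ↪o Fin n, ∀ i j : Fin m, σ i < σ j ↔ π (f i) < π (f j)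

/-- `μ` dominates `lam`: the partial sums of the parts of `lam` (extended by zeros) are at most
those of `μ`. The two partitions may have different sizes. -/
def IsDominatedBy (lam μ : YoungDiagram) : Prop :=
  ∀ k : ℕ, ∑ i ∈ Finset.range k, lam.rowLen i ≤ ∑ i ∈ Finset.range k, μ.rowLen i

/-- `μ` doubly dominates `lam`: `μ` dominates `lam`, and the conjugate of `μ` dominates the
conjugate of `lam`. -/
def IsDoublyDominatedBy (lam μ : YoungDiagram) : Prop :=
  IsDominatedBy lam μ ∧ IsDominatedBy lam.transpose μ.transpose

end RSK

/-! Greene's theorem reduces the claim to chains. The sum of the first `k` row lengths of the shape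
is the largest total length of `k` disjoint increasing subsequences, and the transposed shape does
the same for decreasing ones. A family of such subsequences of `σ` is carried by an involvement to
one of the same total length in `π`, so both maxima can only grow.

Greene's theorem holds because a word is Knuth equivalent to the reading word of its insertion
tableau (`knuthEquiv_readingWord_insertionTableau`), and an elementary Knuth move preserves these
maxima (`HasChains.swap_of_between` is the hard direction). For a reading word the maximum is
visible: the first `k` rows attain it, and an increasing chain meets each column at most once
(`hasChains_iff_le_sum_rowLen`). -/

namespace RSK

/-! ### Families of disjoint chains under an adjacent swap -/

section Coloring

variable {α : Type*} [DecidableEq α]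

/-- The word `w` has `k` disjoint subsequences, each increasing for `r`, of total length at least
`N`. The subsequences are the classes of the colors below `k` of a coloring of the letters. -/
def HasChains (r : α → α → Prop) (k : ℕ) (w : List α) (N : ℕ) : Prop :=
  ∃ c : α → ℕ, w.Pairwise (fun a b => c a = c b → c a < k → r a b) ∧
    N ≤ (w.toFinset.filter (c · < k)).card

theorem HasChains.reverse {r : α → α → Prop} {k N : ℕ} {w : List α} (h : HasChains r k w N) :
    HasChains (flip r) k w.reverse N := by
  obtain ⟨c, hc, hN⟩ := h
  refine ⟨c, List.pairwise_reverse.2 (hc.imp fun h h1 h2 => ?_), by simpa using hN⟩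
  exact h h1.symm (h1 ▸ h2)

/-- The same coloring works: only the pair `x`, `z` changes order, and its new order agrees with
`r`. -/
theorem HasChains.swap_of_rel {r : α → α → Prop} {k N : ℕ} {p s : List α} {x z : α}
    (hxz : r x z) (h : HasChains r k (p ++ z :: x :: s) N) :
    HasChains r k (p ++ x :: z :: s) N := by
  obtain ⟨c, hc, hN⟩ := h
  refine ⟨c, ?_, ?_⟩
  · simp only [List.pairwise_append, List.pairwise_cons, List.mem_cons, forall_eq_or_imp] at hc ⊢
    grind
  · have : (p ++ x :: z :: s).toFinset = (p ++ z :: x :: s).toFinset := by ext; simp; tauto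
    rwa [this]

/-- The coloring fails only when `x` and `z` lie in one chain. The neighbour `y`, which cannot
belong to that chain, then repairs it: `y` follows `x` in place of `z`. -/
theorem HasChains.swap_of_between {r : α → α → Prop} [IsStrictOrder α r] {k N : ℕ}
    {p s : List α} {x y z : α} (hnd : (p ++ x :: z :: y :: s).Nodup) (hxy : r x y) (hyz : r y z)
    (h : HasChains r k (p ++ x :: z :: y :: s) N) :
    HasChains r k (p ++ z :: x :: y :: s) N := by
  obtain ⟨c, hc, hN⟩ := h
  have ht : ∀ {a b c : α}, r a b → r b c → r a c := fun h h' => _root_.trans h h'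
  have hzy : ¬ r z y := fun h => asymm h hyz
  have hS : (p ++ z :: x :: y :: s).toFinset = (p ++ x :: z :: y :: s).toFinset := by
    ext; simp; tauto
  by_cases hi : c x = c z ∧ c x < k
  swap
  · refine ⟨c, ?_, hS ▸ hN⟩
    simp only [List.pairwise_append, List.pairwise_cons, List.mem_cons, forall_eq_or_imp] at hc ⊢
    grind
  obtain ⟨hxz, hxk⟩ := hi
  simp only [List.nodup_append, List.nodup_cons, List.mem_cons] at hnd
  simp only [List.pairwise_append, List.pairwise_cons, List.mem_cons, forall_eq_or_imp] at hc
  obtain ⟨hp, ⟨⟨hxz', hxy', hxs⟩, ⟨hzy', hzs⟩, hys, hs⟩, hps⟩ := hc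
  have hyx : c y ≠ c x := fun h => hzy (hzy' (hxz ▸ h.symm) (hxz ▸ hxk))
  by_cases hj : c y < k
  -- Chains `A x z B` and `C y D` exchange tails and become `A x y D` and `C z B`; the tails `B`,
  -- `D` are the letters of `s` in the two colors.
  · set c' : α → ℕ := fun a => if a = z then c y else if a = y then c x else
      if a ∈ s then (if c a = c x then c y else if c a = c y then c x else c a) else c a with hc'
    have ez : c' z = c y := by simp [hc']
    have ey : c' y = c x := by grind
    have ex : c' x = c x := by grind
    have ep : ∀ a ∈ p, c' a = c a := by grind
    have es : ∀ a ∈ s, c' a = if c a = c x then c y else if c a = c y then c x else c a := by grind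
    clear_value c'
    refine ⟨c', ?_, ?_⟩
    · simp only [List.pairwise_append, List.pairwise_cons, List.mem_cons, forall_eq_or_imp]
      refine ⟨hp.imp_of_mem fun {a b} ha hb h => by rw [ep a ha, ep b hb]; exact h,
        ⟨⟨by grind, by grind, fun b hb => ?_⟩, ⟨by grind, fun b hb => ?_⟩, fun b hb => ?_, ?_⟩,
        fun a ha => ⟨?_, ?_, ?_, fun b hb => ?_⟩⟩
      · have := hzs b hb; have := es b hb; grind
      · have := hys b hb; have := es b hb; grind
      · have := hys b hb; have := es b hb; grind
      · refine hs.imp_of_mem fun {a b} ha hb h => ?_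
        have := es a ha; have := es b hb; grind
      · have := ep a ha; have := hps a ha; grind
      · have := ep a ha; have := hps a ha; grind
      · have := ep a ha; have := hps a ha; grind
      · have := ep a ha
        obtain ⟨h1, h2, h3, h4⟩ := hps a ha
        have := h4 b hb; have := es b hb; have := hzs b hb; have := hys b hb
        grind
    · rw [hS]
      refine hN.trans (Finset.card_le_card fun a ha => ?_)
      simp only [Finset.mem_filter, List.mem_toFinset, List.mem_append, List.mem_cons] at ha ⊢
      refine ⟨ha.1, ?_⟩
      rcases ha.1 with h | h | h | h | h <;> grind
  -- Here `y` is in no chain, so it replaces `z`: the chain `A x z B` becomes `A x y B`.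
  · refine ⟨fun a => c (Equiv.swap y z a), ?_, ?_⟩
    · have ez : c (Equiv.swap y z z) = c y := by simp
      have ey : c (Equiv.swap y z y) = c x := by simp [hxz]
      have ex : c (Equiv.swap y z x) = c x := by
        rw [Equiv.swap_apply_of_ne_of_ne] <;> grind
      have ep : ∀ a ∈ p, c (Equiv.swap y z a) = c a := fun a ha => by
        rw [Equiv.swap_apply_of_ne_of_ne] <;> grind
      have es : ∀ a ∈ s, c (Equiv.swap y z a) = c a := fun a ha => by
        rw [Equiv.swap_apply_of_ne_of_ne] <;> grind
      simp only [List.pairwise_append, List.pairwise_cons, List.mem_cons, forall_eq_or_imp,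
        ez, ey, ex]
      refine ⟨hp.imp_of_mem fun {a b} ha hb h => by rw [ep a ha, ep b hb]; exact h,
        ⟨⟨by grind, by grind, by grind⟩, ⟨by grind, fun b hb => ?_⟩, fun b hb => ?_, ?_⟩,
        fun a ha => ⟨?_, ?_, ?_, fun b hb => ?_⟩⟩
      · rw [es b hb]; exact hxs b hb
      · have := es b hb; have := hzs b hb; grind
      · exact hs.imp_of_mem fun {a b} ha hb h => by rw [es a ha, es b hb]; exact h
      all_goals rw [ep a ha]; have h1 := hps a ha
      · grind
      · grind
      · grind
      · rw [es b hb]; exact h1.2.2.2 b hb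
    · rw [hS]
      refine hN.trans (Finset.card_le_card_of_injOn (Equiv.swap y z) (fun a ha => ?_)
        (Equiv.injective _).injOn)
      simp only [Finset.coe_filter, List.mem_toFinset, List.mem_append, List.mem_cons,
        Set.mem_ofPred_eq, Equiv.swap_apply_self] at ha ⊢
      simp only [Equiv.swap_apply_def]
      grind

end Coloring

/-! ### Knuth equivalence preserves the chain maxima -/

section Knuth

variable {α : Type*} [LinearOrder α]

/-- Knuth equivalence of words. -/
inductive KnuthEquiv : List α → List α → Prop
  | refl (w) : KnuthEquiv w w
  | symm {u w} : KnuthEquiv u w → KnuthEquiv w u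
  | trans {u v w} : KnuthEquiv u v → KnuthEquiv v w → KnuthEquiv u w
  | before (p s : List α) {x y z : α} : x < y → y < z →
      KnuthEquiv (p ++ x :: z :: y :: s) (p ++ z :: x :: y :: s)
  | after (p s : List α) {x y z : α} : x < y → y < z →
      KnuthEquiv (p ++ y :: x :: z :: s) (p ++ y :: z :: x :: s)

namespace KnuthEquiv

theorem perm {u w : List α} (h : KnuthEquiv u w) : u.Perm w := by
  induction h with
  | refl => rfl
  | symm _ ih => exact ih.symm
  | trans _ _ ih ih' => exact ih.trans ih'
  | before p s _ _ => exact (List.Perm.swap _ _ _).append_left p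
  | after p s _ _ => exact ((List.Perm.swap _ _ _).cons _).append_left p

theorem append_left (q : List α) {u w : List α} (h : KnuthEquiv u w) :
    KnuthEquiv (q ++ u) (q ++ w) := by
  induction h with
  | refl => exact refl _
  | symm _ ih => exact ih.symm
  | trans _ _ ih ih' => exact ih.trans ih'
  | before p s h h' => simpa using before (q ++ p) s h h'
  | after p s h h' => simpa using after (q ++ p) s h h'

theorem append_right (q : List α) {u w : List α} (h : KnuthEquiv u w) :
    KnuthEquiv (u ++ q) (w ++ q) := by
  induction h with
  | refl => exact refl _
  | symm _ ih => exact ih.symm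
  | trans _ _ ih ih' => exact ih.trans ih'
  | before p s h h' => simpa using before p (s ++ q) h h'
  | after p s h h' => simpa using after p (s ++ q) h h'

/-- A letter strictly between `x` and `z` for `r` and adjacent to them allows to swap them. -/
theorem hasChains_before_iff {r : α → α → Prop} [IsStrictOrder α r] {k N : ℕ}
    {p s : List α} {x y z : α} (hnd : (p ++ x :: z :: y :: s).Nodup) (hxy : r x y) (hyz : r y z) :
    HasChains r k (p ++ x :: z :: y :: s) N ↔ HasChains r k (p ++ z :: x :: y :: s) N :=
  ⟨.swap_of_between hnd hxy hyz, .swap_of_rel (_root_.trans hxy hyz)⟩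

/-- Reversing the word and flipping `r` turns this move into the previous one, with `x` and `z`
exchanging roles. -/
theorem hasChains_after_iff {r : α → α → Prop} [IsStrictOrder α r] {k N : ℕ}
    {p s : List α} {x y z : α} (hnd : (p ++ y :: x :: z :: s).Nodup) (hxy : r x y) (hyz : r y z) :
    HasChains r k (p ++ y :: x :: z :: s) N ↔ HasChains r k (p ++ y :: z :: x :: s) N := by
  have hr : ∀ w : List α, HasChains r k w N ↔ HasChains (flip r) k w.reverse N := fun w =>
    ⟨.reverse, fun h => by simpa [flip] using h.reverse⟩
  have : IsStrictOrder α (flip r) := inferInstanceAs (IsStrictOrder α (Function.swap r))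
  have hnd' := List.nodup_reverse.2 hnd
  rw [hr, hr]
  simp only [List.reverse_append, List.reverse_cons, List.append_assoc, List.cons_append,
    List.nil_append] at hnd' ⊢
  exact hasChains_before_iff (r := flip r) hnd' hyz hxy

theorem hasChains_lt_iff {u w : List α} (h : KnuthEquiv u w) (hu : u.Nodup) {k N : ℕ} :
    HasChains (· < ·) k u N ↔ HasChains (· < ·) k w N := by
  induction h with
  | refl => rfl
  | symm h ih => exact (ih (h.perm.nodup_iff.2 hu)).symm
  | trans h _ ih ih' => exact (ih hu).trans (ih' (h.perm.nodup_iff.1 hu))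
  | before p s h h' => exact hasChains_before_iff hu h h'
  | after p s h h' => exact hasChains_after_iff hu h h'

theorem hasChains_gt_iff {u w : List α} (h : KnuthEquiv u w) (hu : u.Nodup) {k N : ℕ} :
    HasChains (· > ·) k u N ↔ HasChains (· > ·) k w N := by
  induction h with
  | refl => rfl
  | symm h ih => exact (ih (h.perm.nodup_iff.2 hu)).symm
  | trans h _ ih ih' => exact (ih hu).trans (ih' (h.perm.nodup_iff.1 hu))
  -- For `>` the betweenness reads `z > y > x`, so the move is used with `x` and `z` exchanged,
  -- hence backwards.
  | before p s h h' =>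
    exact (hasChains_before_iff ((before p s h h').perm.nodup_iff.1 hu) h' h).symm
  | after p s h h' =>
    exact (hasChains_after_iff ((after p s h h').perm.nodup_iff.1 hu) h' h).symm

end KnuthEquiv

end Knuth

/-! ### Schensted insertion as a sequence of Knuth moves -/

section Insertion

variable {α : Type*}

/-- The row reading word of a tableau: the rows are read from bottom to top. -/
def readingWord (T : List (List α)) : List α := T.reverse.flatten

@[simp]
theorem readingWord_nil : readingWord ([] : List (List α)) = [] := rfl

@[simp]
theorem readingWord_cons (r : List α) (T : List (List α)) :
    readingWord (r :: T) = readingWord T ++ r := by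
  simp [readingWord]

variable [LinearOrder α]

theorem rowInsert_eq_append : ∀ {r : List α} {x : α}, (rowInsert r x).2 = none →
    (rowInsert r x).1 = r ++ [x]
  | [], x, _ => rfl
  | a :: r, x, h => by
    by_cases hx : x < a
    · simp [rowInsert, if_pos hx] at h
    · simp only [rowInsert, if_neg hx] at h ⊢
      rw [rowInsert_eq_append h, List.cons_append]

theorem mem_of_mem_rowInsert : ∀ {r : List α} {x b : α}, b ∈ (rowInsert r x).1 → b = x ∨ b ∈ r
  | [], x, b, h => by simpa [rowInsert] using h
  | a :: r, x, b, h => by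
    by_cases hx : x < a
    · simp only [rowInsert, if_pos hx, List.mem_cons] at h ⊢
      tauto
    · simp only [rowInsert, if_neg hx, List.mem_cons] at h ⊢
      rcases h with h | h
      · exact .inr (.inl h)
      · have := mem_of_mem_rowInsert h
        tauto

theorem pairwise_lt_rowInsert : ∀ {r : List α} {x : α}, r.Pairwise (· < ·) → x ∉ r →
    (rowInsert r x).1.Pairwise (· < ·)
  | [], x, _, _ => by simp [rowInsert]
  | a :: r, x, h, hn => by
    rw [List.pairwise_cons] at h
    rw [List.mem_cons, not_or] at hn
    by_cases hx : x < a
    · simp only [rowInsert, if_pos hx]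
      exact List.pairwise_cons.2 ⟨fun b hb => hx.trans (h.1 b hb), h.2⟩
    · simp only [rowInsert, if_neg hx]
      refine List.pairwise_cons.2 ⟨fun b hb => ?_, pairwise_lt_rowInsert h.2 hn.2⟩
      rcases mem_of_mem_rowInsert hb with rfl | hb
      · exact lt_of_le_of_ne (not_lt.1 hx) (Ne.symm hn.1)
      · exact h.1 b hb

/-- Provides the intermediate letter `b` that lets the bumped `y` move left past a smaller entry in
`knuthEquiv_rowInsert`. -/
theorem exists_rowInsert_eq_cons : ∀ {r : List α} {x y : α}, (rowInsert r x).2 = some y →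
    ∃ b t, (rowInsert r x).1 = b :: t ∧ b < y
  | [], x, y, h => by simp [rowInsert] at h
  | a :: r, x, y, h => by
    by_cases hx : x < a
    · simp only [rowInsert, if_pos hx, Option.some.injEq] at h ⊢
      exact ⟨x, r, rfl, h ▸ hx⟩
    · simp only [rowInsert, if_neg hx] at h ⊢
      exact ⟨a, _, rfl, lt_of_le_of_lt (not_lt.1 hx) (lt_of_rowInsert_eq_some h)⟩

/-- The letter `x` moves left past each entry of `r`; the entry preceding the one it passes is the
intermediate letter. -/
theorem knuthEquiv_append_singleton {a x : α} (hx : x < a) : ∀ {r : List α},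
    (a :: r).Pairwise (· < ·) → KnuthEquiv (a :: r ++ [x]) (a :: x :: r)
  | [], _ => .refl _
  | b :: r, h => by
    have hab : a < b := (List.pairwise_cons.1 h).1 b List.mem_cons_self
    have ih := knuthEquiv_append_singleton (hx.trans hab) (List.pairwise_cons.1 h).2
    exact (ih.append_left [a]).trans (KnuthEquiv.after [] r hx hab).symm

theorem knuthEquiv_rowInsert : ∀ {r : List α} {x y : α}, r.Pairwise (· < ·) → x ∉ r →
    (rowInsert r x).2 = some y → KnuthEquiv (r ++ [x]) (y :: (rowInsert r x).1)
  | [], x, y, _, _, h => by simp [rowInsert] at h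
  | a :: r, x, y, hr, hn, h => by
    have hs := pairwise_lt_rowInsert hr hn
    by_cases hx : x < a
    · simp only [rowInsert, if_pos hx, Option.some.injEq] at h ⊢
      subst h
      exact knuthEquiv_append_singleton hx hr
    · simp only [rowInsert, if_neg hx] at h hs ⊢
      have ih := knuthEquiv_rowInsert (List.pairwise_cons.1 hr).2
        (fun hm => hn (List.mem_cons_of_mem _ hm)) h
      obtain ⟨b, t, hb, hby⟩ := exists_rowInsert_eq_cons h
      rw [hb] at ih hs ⊢
      have hab : a < b := (List.pairwise_cons.1 hs).1 b List.mem_cons_self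
      exact (ih.append_left [a]).trans (KnuthEquiv.before [] t hab hby)

/-- The bumped letter emerges to the left of its row, which is the right end of the reading word of
the rows below: exactly where the next insertion expects it. -/
theorem knuthEquiv_readingWord_insert : ∀ {T : List (List α)} {x : α},
    (∀ r ∈ T, r.Pairwise (· < ·)) → (readingWord T ++ [x]).Nodup →
    KnuthEquiv (readingWord T ++ [x]) (readingWord (insert T x)) ∧
      ∀ r ∈ insert T x, r.Pairwise (· < ·)
  | [], x, _, _ => by simpa [insert] using KnuthEquiv.refl [x]
  | r :: T, x, hT, hnd => by
    rw [readingWord_cons, List.append_assoc] at hnd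
    have hn : x ∉ r := by
      have := List.nodup_append.1 (List.nodup_append.1 hnd).2.1
      exact fun h => this.2.2 x h x (by simp) rfl
    have hr := hT r List.mem_cons_self
    have hr' := pairwise_lt_rowInsert hr hn
    rcases hy : (rowInsert r x).2 with _ | y
    · simp only [insert, hy, readingWord_cons, rowInsert_eq_append hy, List.append_assoc]
      refine ⟨.refl _, ?_⟩
      rw [← rowInsert_eq_append hy]
      exact List.forall_mem_cons.2 ⟨hr', fun s hs => hT s (List.mem_cons_of_mem _ hs)⟩
    · simp only [insert, hy, readingWord_cons, List.append_assoc]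
      have h1 := (knuthEquiv_rowInsert hr hn hy).append_left (readingWord T)
      have hnd' : (readingWord T ++ [y]).Nodup := by
        have := h1.perm.nodup_iff.1 hnd
        rw [List.append_cons] at this
        exact (List.nodup_append.1 this).1
      have ih := knuthEquiv_readingWord_insert
        (fun s hs => hT s (List.mem_cons_of_mem _ hs)) hnd'
      refine ⟨h1.trans ?_, List.forall_mem_cons.2 ⟨hr', ih.2⟩⟩
      simpa using ih.1.append_right (rowInsert r x).1

theorem knuthEquiv_readingWord_foldl : ∀ {w : List α} {T : List (List α)},
    (∀ r ∈ T, r.Pairwise (· < ·)) → (readingWord T ++ w).Nodup →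
    KnuthEquiv (readingWord T ++ w) (readingWord (w.foldl insert T)) ∧
      ∀ r ∈ w.foldl insert T, r.Pairwise (· < ·)
  | [], T, hT, _ => by simpa using ⟨KnuthEquiv.refl _, hT⟩
  | x :: w, T, hT, hnd => by
    rw [List.append_cons] at hnd ⊢
    obtain ⟨h1, h2⟩ := knuthEquiv_readingWord_insert hT (List.nodup_append.1 hnd).1
    have h1 := h1.append_right w
    have ih := knuthEquiv_readingWord_foldl h2 (h1.perm.nodup_iff.1 hnd)
    exact ⟨h1.trans ih.1, ih.2⟩

theorem knuthEquiv_readingWord_insertionTableau {w : List α} (hw : w.Nodup) :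
    KnuthEquiv w (readingWord (insertionTableau w)) :=
  (knuthEquiv_readingWord_foldl (T := []) (by simp) hw).1

theorem pairwise_lt_of_mem_insertionTableau {w : List α} (hw : w.Nodup) :
    ∀ r ∈ insertionTableau w, r.Pairwise (· < ·) :=
  (knuthEquiv_readingWord_foldl (T := []) (by simp) hw).2

end Insertion

/-! ### Rows and columns of a tableau as functions of its entries -/

section Coordinates

variable {α : Type*} [LinearOrder α]

theorem ColStrict.exists_getElem?_lt : ∀ {r s : List α} {j : ℕ} {a : α}, ColStrict r s →
    s[j]? = some a → ∃ b, r[j]? = some b ∧ b < a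
  | _, [], _, _, _, h => by simp at h
  | [], _ :: _, _, _, hc, _ => hc.elim
  | b :: r, c :: s, 0, a, hc, h => by
    simp only [List.getElem?_cons_zero, Option.some.injEq] at h
    exact ⟨b, rfl, h ▸ hc.1⟩
  | b :: r, c :: s, j + 1, a, hc, h => by
    rw [List.getElem?_cons_succ] at h ⊢
    exact hc.2.exists_getElem?_lt h

/-- Upgrades column strictness from adjacent rows to all pairs of rows, as `exists_coordinates`
requires. -/
theorem ColStrict.trans : ∀ {r s t : List α}, ColStrict r s → ColStrict s t → ColStrict r t
  | _, _, [], _, _ => by simp [ColStrict]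
  | _, [], _ :: _, _, h => h.elim
  | [], _ :: _, _, h, _ => h.elim
  | _ :: _, _ :: _, _ :: _, h, h' => ⟨h.1.trans h'.1, h.2.trans h'.2⟩

/-- The row index `ρ` and the column index `κ` of the entries of a tableau. -/
theorem exists_coordinates : ∀ {T : List (List α)}, (∀ r ∈ T, r.Pairwise (· < ·)) →
    T.Pairwise ColStrict → (readingWord T).Nodup → ∃ ρ κ : α → ℕ,
      (readingWord T).Pairwise (fun a b => ρ a = ρ b → a < b) ∧
      (readingWord T).Pairwise (fun a b => κ a = κ b → b < a) ∧
      (∀ a ∈ readingWord T, ∃ r, T[ρ a]? = some r ∧ r[κ a]? = some a) ∧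
      ∀ i r j, T[i]? = some r → j < r.length → ∃ a ∈ readingWord T, ρ a = i ∧ κ a = j
  | [], _, _, _ => ⟨0, 0, by simp, by simp, by simp, by simp⟩
  | r :: T, hT, hc, hnd => by
    rw [readingWord_cons] at hnd ⊢
    obtain ⟨hndT, hndr, hd⟩ := List.nodup_append.1 hnd
    rw [List.forall_mem_cons] at hT
    rw [List.pairwise_cons] at hc
    obtain ⟨ρ, κ, h1, h2, h3, h4⟩ := exists_coordinates hT.2 hc.2 hndT
    have hn : ∀ a ∈ readingWord T, a ∉ r := fun a ha hr => hd a ha a hr rfl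
    have hidx : ∀ b ∈ r, r[r.idxOf b]? = some b := fun b hb => by
      rw [List.getElem?_eq_getElem (List.idxOf_lt_length_of_mem hb), List.getElem_idxOf]
    refine ⟨fun a => if a ∈ r then 0 else ρ a + 1, fun a => if a ∈ r then r.idxOf a else κ a,
      ?_, ?_, fun a ha => ?_, fun i s j hi hj => ?_⟩
    · refine List.pairwise_append.2 ⟨h1.imp_of_mem fun {a b} ha hb h => ?_,
        hT.1.imp fun h _ => by exact h, fun a ha b hb => ?_⟩
      · simpa [hn a ha, hn b hb] using h
      · simp [hn a ha, hb]
    · refine List.pairwise_append.2 ⟨h2.imp_of_mem fun {a b} ha hb h => ?_,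
        hT.1.imp_of_mem fun {a b} ha hb h => ?_, fun a ha b hb => ?_⟩
      · simpa [hn a ha, hn b hb] using h
      · simp only [if_pos ha, if_pos hb]
        intro he
        exact absurd ((List.idxOf_inj ha).1 he) h.ne
      · simp only [if_neg (hn a ha), if_pos hb]
        intro he
        -- The entry of the top row in the column of `a` is `b`, so column strictness gives `b < a`.
        obtain ⟨s, hs, hsa⟩ := h3 a ha
        obtain ⟨b', hb', hlt⟩ := (hc.1 s (List.mem_of_getElem? hs)).exists_getElem?_lt hsa
        rw [he, hidx b hb, Option.some.injEq] at hb'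
        exact hb' ▸ hlt
    · by_cases hr : a ∈ r
      · exact ⟨r, by simp [hr], by simp [hr]⟩
      · simpa [hr] using h3 a ((List.mem_append.1 ha).resolve_right hr)
    · rcases i with _ | i
      · simp only [List.getElem?_cons_zero, Option.some.injEq] at hi
        subst hi
        refine ⟨r[j], by simp, by simp, ?_⟩
        simp [hndr.idxOf_getElem]
      · rw [List.getElem?_cons_succ] at hi
        obtain ⟨a, ha, hi, hj⟩ := h4 i s j hi hj
        exact ⟨a, by simp [ha], by simp [hn a ha, hi], by simp [hn a ha, hj]⟩

end Coordinates

/-! ### Greene's theorem for words filling a Young diagram -/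

section Greene

variable {α : Type*} [DecidableEq α]

theorem sum_rowLen_eq_card (μ : YoungDiagram) (k : ℕ) :
    ∑ i ∈ Finset.range k, μ.rowLen i = (μ.cells.filter (·.1 < k)).card := by
  rw [Finset.card_eq_sum_card_fiberwise (f := Prod.fst) (t := Finset.range k)
    (fun c hc => by simpa using (Finset.mem_filter.1 hc).2)]
  refine Finset.sum_congr rfl fun i hi => ?_
  rw [YoungDiagram.rowLen_eq_card, YoungDiagram.row, Finset.filter_filter]
  congr 1
  refine Finset.filter_congr fun c _ => ⟨fun h => ⟨?_, h⟩, And.right⟩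
  simpa [h] using hi

/-- The left side bounds what `k` chains can take from column `j`; the right side is what the first
`k` rows take from it. -/
theorem min_colLen_eq_card (μ : YoungDiagram) (k j : ℕ) :
    min k (μ.colLen j) = ((μ.cells.filter (·.1 < k)).filter (·.2 = j)).card := by
  have : (μ.cells.filter (·.1 < k)).filter (·.2 = j) =
      (Finset.range (min k (μ.colLen j))).map ⟨fun i => (i, j), fun a b h => by simpa using h⟩ := by
    ext ⟨a, b⟩
    simp only [Finset.mem_filter, YoungDiagram.mem_cells, Finset.mem_map, Finset.mem_range,
      lt_min_iff, YoungDiagram.mem_iff_lt_colLen]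
    constructor
    · rintro ⟨⟨h, h'⟩, rfl⟩
      exact ⟨a, ⟨h', h⟩, rfl⟩
    · rintro ⟨_, ⟨h', h⟩, ⟨⟩⟩
      exact ⟨⟨h, h'⟩, rfl⟩
  rw [this, Finset.card_map, Finset.card_range]

/-- The maximal size of a union of `k` chains, for a word whose letters fill a Young diagram with
rows increasing and columns decreasing along the word. -/
theorem hasChains_iff_le_sum_rowLen {r : α → α → Prop} [IsStrictOrder α r] {w : List α}
    {μ : YoungDiagram} {ρ κ : α → ℕ}
    (hρ : w.Pairwise (fun a b => ρ a = ρ b → r a b))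
    (hκ : w.Pairwise (fun a b => κ a = κ b → r b a))
    (hμ : ∀ c, c ∈ μ ↔ ∃ a ∈ w, (ρ a, κ a) = c) {k N : ℕ} :
    HasChains r k w N ↔ N ≤ ∑ i ∈ Finset.range k, μ.rowLen i := by
  -- Distinct letters sharing both a chain and a column would be related by `r` in both directions.
  have key : ∀ {k : ℕ} {f g : α → ℕ}, (w.Pairwise fun a b => f a = f b → f a < k → r a b) →
      (w.Pairwise fun a b => g a = g b → r b a) →
      ∀ a ∈ w, ∀ b ∈ w, f a < k → f a = f b → g a = g b → a = b := by
    intro k f g hf hg a ha b hb hk hfe hge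
    have h2 : w.Pairwise fun a b => f a < k → f a = f b → g a = g b → a = b :=
      (hf.and hg).imp fun h hk e e' => (asymm (h.1 e hk) (h.2 e')).elim
    refine h2.forall_of_forall_of_flip (fun _ _ _ _ _ => rfl) (h2.imp ?_) ha hb hk hfe hge
    intro x y h hk e e'
    exact (h (e ▸ hk) e.symm e'.symm).symm
  have hinj : Set.InjOn (fun a => (ρ a, κ a)) (w.toFinset : Set α) := by
    intro a ha b hb h
    simp only [List.coe_toFinset, Set.mem_ofPred_eq] at ha hb
    -- The bound `ρ a + 1` only serves to make `ρ a < k` true.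
    exact key (k := ρ a + 1) (hρ.imp fun h e _ => h e) hκ a ha b hb (Nat.lt_succ_self _)
      (congrArg Prod.fst h) (congrArg Prod.snd h)
  have himg : ∀ (P : ℕ × ℕ → Prop) [DecidablePred P],
      (w.toFinset.filter fun a => P (ρ a, κ a)).card = (μ.cells.filter P).card := by
    intro P _
    rw [← Finset.card_image_of_injOn (hinj.mono (Finset.coe_subset.2 (Finset.filter_subset _ _)))]
    congr 1
    ext c
    simp only [Finset.mem_image, Finset.mem_filter, List.mem_toFinset, YoungDiagram.mem_cells, hμ]
    constructor
    · rintro ⟨a, ⟨ha, hP⟩, rfl⟩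
      exact ⟨⟨a, ha, rfl⟩, hP⟩
    · rintro ⟨⟨a, ha, rfl⟩, hP⟩
      exact ⟨a, ⟨ha, hP⟩, rfl⟩
  rw [sum_rowLen_eq_card]
  constructor
  · rintro ⟨c, hc, hN⟩
    refine hN.trans ?_
    have hm : ∀ a ∈ w, κ a ∈ w.toFinset.image κ := fun a ha =>
      Finset.mem_image_of_mem _ (List.mem_toFinset.2 ha)
    rw [← himg (fun c => c.1 < k),
      Finset.card_eq_sum_card_fiberwise (f := κ) (s := w.toFinset.filter fun a => c a < k)
        (t := w.toFinset.image κ) (fun a ha => hm a (by simp at ha; exact ha.1)),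
      Finset.card_eq_sum_card_fiberwise (f := κ) (s := w.toFinset.filter fun a => ρ a < k)
        (t := w.toFinset.image κ) (fun a ha => hm a (by simp at ha; exact ha.1))]
    -- Column by column: the chosen letters in column `j` have distinct colors below `k`, and there
    -- are at most `μ.colLen j` of them.
    refine Finset.sum_le_sum fun j _ => ?_
    rw [Finset.filter_filter (fun a => ρ a < k), himg (fun c => c.1 < k ∧ c.2 = j),
      ← Finset.filter_filter, ← min_colLen_eq_card, le_min_iff]
    constructor
    · refine (Finset.card_le_card_of_injOn (t := Finset.range k) c (fun a ha => ?_)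
        fun a ha b hb h => ?_).trans_eq (Finset.card_range k)
      · simp only [Finset.coe_filter, Finset.mem_filter, Set.mem_ofPred_eq] at ha
        simpa using ha.1.2
      · simp only [Finset.coe_filter, Finset.mem_filter, Set.mem_ofPred_eq,
          List.mem_toFinset] at ha hb
        exact key hc hκ a ha.1.1 b hb.1.1 ha.1.2 h (ha.2.trans hb.2.symm)
    · rw [YoungDiagram.colLen_eq_card, YoungDiagram.col, ← himg (fun c => c.2 = j)]
      exact Finset.card_le_card (Finset.filter_subset_filter _ (Finset.filter_subset _ _))
  · intro hN
    exact ⟨ρ, hρ.imp fun h e _ => h e, by rwa [himg (fun c => c.1 < k)]⟩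

end Greene

/-! ### Greene's theorem for shapes and transport along an involvement -/

section Shape

/-- **Greene's theorem** for the insertion tableau of a word with distinct letters. -/
theorem hasChains_insertionTableau {α : Type*} [LinearOrder α] {w : List α} (hw : w.Nodup)
    (k N : ℕ) :
    (HasChains (· < ·) k w N ↔ N ≤ ∑ i ∈ Finset.range k, (YoungDiagram.ofRowLens
        ((insertionTableau w).map List.length) (sortedGE_insertionTableau w)).rowLen i) ∧
      (HasChains (· > ·) k w N ↔ N ≤ ∑ i ∈ Finset.range k, (YoungDiagram.ofRowLens
        ((insertionTableau w).map List.length) (sortedGE_insertionTableau w)).transpose.rowLen i) := by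
  have hK := knuthEquiv_readingWord_insertionTableau hw
  have hnd := hK.perm.nodup_iff.1 hw
  have : IsTrans (List α) ColStrict := ⟨fun _ _ _ => ColStrict.trans⟩
  obtain ⟨ρ, κ, hρ, hκ, h1, h2⟩ := exists_coordinates (pairwise_lt_of_mem_insertionTableau hw)
    (isChain_insertionTableau w).pairwise hnd
  have hμ : ∀ c, c ∈ YoungDiagram.ofRowLens ((insertionTableau w).map List.length)
      (sortedGE_insertionTableau w) ↔ ∃ a ∈ readingWord (insertionTableau w), (ρ a, κ a) = c := by
    rintro ⟨i, j⟩
    rw [YoungDiagram.mem_ofRowLens]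
    simp only [List.length_map, List.getElem_map, Prod.mk.injEq]
    constructor
    · rintro ⟨hi, hj⟩
      exact h2 i _ j (List.getElem?_eq_getElem hi) hj
    · rintro ⟨a, ha, rfl, rfl⟩
      obtain ⟨r, hr, hra⟩ := h1 a ha
      obtain ⟨hi, rfl⟩ := List.getElem?_eq_some_iff.1 hr
      exact ⟨hi, (List.getElem?_eq_some_iff.1 hra).1⟩
  rw [hK.hasChains_lt_iff hw, hK.hasChains_gt_iff hw]
  -- For `>` the columns take the role of the rows, which transposes the diagram.
  refine ⟨hasChains_iff_le_sum_rowLen hρ hκ hμ,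
    hasChains_iff_le_sum_rowLen (ρ := κ) (κ := ρ) hκ hρ fun c => ?_⟩
  rw [YoungDiagram.mem_transpose, hμ]
  simp only [Prod.ext_iff, Prod.fst_swap, Prod.snd_swap, and_comm]

theorem HasChains.ofFn {α β : Type*} [DecidableEq α] [DecidableEq β] {m n : ℕ} {r : α → α → Prop}
    {r' : β → β → Prop} {σ : Fin m → α} {π : Fin n → β} (hπ : π.Injective)
    (f : Fin m ↪o Fin n) (h : ∀ i j, r (σ i) (σ j) → r' (π (f i)) (π (f j))) {k N : ℕ}
    (hN : HasChains r k (List.ofFn σ) N) : HasChains r' k (List.ofFn π) N := by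
  obtain ⟨c, hc, hN⟩ := hN
  have hinj : (π ∘ f).Injective := hπ.comp f.injective
  -- The default color `k` leaves the letters outside the image of `f` in no chain.
  set c' : β → ℕ := Function.extend (π ∘ f) (c ∘ σ) fun _ => k with hc'
  have hf : ∀ i, c' (π (f i)) = c (σ i) := fun i => hinj.extend_apply _ _ i
  have hk : ∀ a, c' (π a) < k → ∃ i, f i = a := by
    intro a ha
    by_contra hne
    rw [hc', Function.extend_apply' (f := π ∘ f) _ _ _ fun ⟨i, hi⟩ => hne ⟨i, hπ hi⟩] at ha
    exact ha.false
  refine ⟨c', ?_, hN.trans ?_⟩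
  · rw [List.pairwise_ofFn] at hc ⊢
    intro a b hab he hlt
    obtain ⟨i, rfl⟩ := hk a hlt
    obtain ⟨j, rfl⟩ := hk b (he ▸ hlt)
    rw [hf, hf] at he
    rw [hf] at hlt
    exact h i j (hc (f.lt_iff_lt.1 hab) he hlt)
  · refine Finset.card_le_card_of_forall_subsingleton
      (fun a b => ∃ i, σ i = a ∧ π (f i) = b) (fun a ha => ?_) ?_
    · simp only [Finset.mem_filter, List.mem_toFinset, List.mem_ofFn] at ha
      obtain ⟨⟨i, rfl⟩, hlt⟩ := ha
      exact ⟨π (f i), by simpa [hf] using hlt, i, rfl, rfl⟩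
    · rintro b - _ ⟨-, i, rfl, hi⟩ _ ⟨-, j, rfl, hj⟩
      rw [hinj (hi.trans hj.symm)]

end Shape

end RSK

theorem mainTheorem4 {m n : ℕ} (σ : Equiv.Perm (Fin m)) (π : Equiv.Perm (Fin n))
    (h : RSK.IsInvolvedIn σ π) :
    RSK.IsDoublyDominatedBy (RSK.shape σ) (RSK.shape π) := by
  obtain ⟨f, hf⟩ := h
  have hσ := RSK.hasChains_insertionTableau (List.nodup_ofFn.2 σ.injective)
  have hπ := RSK.hasChains_insertionTableau (List.nodup_ofFn.2 π.injective)
  -- `N` is taken to be the maximum for `σ`, attained by `le_rfl`.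
  exact ⟨fun k => (hπ k _).1.1 <| ((hσ k _).1.2 le_rfl).ofFn π.injective f
      fun i j => (hf i j).1,
    fun k => (hπ k _).2.1 <| ((hσ k _).2.2 le_rfl).ofFn π.injective f
      fun i j => (hf j i).1⟩
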